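/- Let $A$ be a (complex, not necessarily unital) $C^*$-algebra. Let $\mathrm{Prim}(A)$ be the set of primitive ideals of $A$ (the kernels of the irreducible $*$-representations of $A$ on Hilbert spaces) with the hull-kernel topology. For $P_1,P_2\in\mathrm{Prim}(A)$ write $P_1\approx P_2$ if $f(P_1)=f(P_2)$ for every bounded continuous function $f:\mathrm{Prim}(A)\to\mathbb{R}$. Let $\mathrm{Glimm}(A)$ be the set of the kernels (intersections) of the $\approx$-classes, identified with $\mathrm{Prim}(A)/{\approx}$, and let $q_A:\mathrm{Prim}(A)\to\mathrm{Glimm}(A)$ be the quotient map. Let $\tau_q$ be the quotient topology on $\mathrm{Glimm}(A)$, and let $\tau_{cr}$ be the weakest topology on $\mathrm{Glimm}(A)$ for which all the functions on $\mathrm{Glimm}(A)$ induced by the bounded continuous real functions on $\mathrm{Prim}(A)$ are continuous. For $a\in A$ and $G\in\mathrm{Glimm}(A)$ let $\|a+G\|$ be the norm of the image of $a$ in $A/G$. (1) If $q_A$ is an open map (for $\tau_q$), then for every $\tau_{cr}$-compact $K\subset\mathrm{Glimm}(A)$ there exist $a\in A$ and $\alpha>0$ such that $$K\subset\{G\in\mathrm{Glimm}(A)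 : \|a+G\|\ge\alpha\}.$$ (2) This applies to quasi-standard $C^*$-algebras: let $P\sim Q$ mean that $P,Q\in\mathrm{Prim}(A)$ cannot be separated by disjoint open subsets of $\mathrm{Prim}(A)$, and call $A$ quasi-standard if $\sim$ is an open equivalence relation, that is, an equivalence relation for which the saturation of every open subset of $\mathrm{Prim}(A)$ is open. If $A$ is quasi-standard, then $q_A$ is open (for $\tau_q$), and hence every $\tau_{cr}$-compact $K\subset\mathrm{Glimm}(A)$ is contained in a set $\{G\in\mathrm{Glimm}(A) : \|a+G\|\ge\alpha\}$ with $a\in A$ and $\alpha>0$. -/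

import Mathlib

open scoped BoundedContinuousFunction

namespace CStarGlimm

universe u

/-- A `*`-representation `π` of `A` on the Hilbert space `H` is irreducible if it is nonzero and the
only closed subspaces of `H` invariant under `π(A)` are `0` and `H`. -/
def IsIrreducibleRep {A : Type u} [NonUnitalCStarAlgebra A] {H : Type u}
    [NormedAddCommGroup H] [InnerProductSpace ℂ H] [CompleteSpace H]
    (π : A →⋆ₙₐ[ℂ] (H →L[ℂ] H)) : Prop :=
  (∃ a : A, π a ≠ 0) ∧
    ∀ M : Submodule ℂ H, IsClosed (M : Set H) → (∀ a : A, ∀ v ∈ M, π a v ∈ M) → M = ⊥ ∨ M = ⊤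

/-- A primitive ideal is the kernel of an irreducible `*`-representation on a Hilbert space. An
irreducible representation is generated by any nonzero vector, hence is unitarily equivalent to one
on a space in the universe of `A`, so the universe of `H` is no restriction. -/
def IsPrimitive {A : Type u} [NonUnitalCStarAlgebra A] (P : TwoSidedIdeal A) : Prop :=
  ∃ (H : Type u) (_ : NormedAddCommGroup H) (_ : InnerProductSpace ℂ H) (_ : CompleteSpace H)
    (π : A →⋆ₙₐ[ℂ] (H →L[ℂ] H)), IsIrreducibleRep π ∧ P = TwoSidedIdeal.ker π

/-- The set `Prim(A)` of primitive ideals of `A`. -/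
def PrimSpace (A : Type u) [NonUnitalCStarAlgebra A] : Type u :=
  {P : TwoSidedIdeal A // IsPrimitive P}

/-- The hull of an ideal `I`: the primitive ideals that contain `I`. -/
def hull {A : Type u} [NonUnitalCStarAlgebra A] (I : TwoSidedIdeal A) : Set (PrimSpace A) :=
  {P | I ≤ P.1}

/-- The kernel of a set of primitive ideals: their intersection. -/
def kernel {A : Type u} [NonUnitalCStarAlgebra A] (W : Set (PrimSpace A)) : TwoSidedIdeal A :=
  sInf (Subtype.val '' W)

theorem IsPrimitive.ne_top {A : Type u} [NonUnitalCStarAlgebra A] {P : TwoSidedIdeal A}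
    (hP : IsPrimitive P) : P ≠ ⊤ := by
  obtain ⟨H, _, _, _, π, ⟨⟨a, ha⟩, -⟩, rfl⟩ := hP
  intro h
  have : a ∈ TwoSidedIdeal.ker π := by rw [h]; trivial
  exact ha ((TwoSidedIdeal.mem_ker π).1 this)

theorem IsPrimitive.mem_or_mem {A : Type u} [NonUnitalCStarAlgebra A] {P : TwoSidedIdeal A}
    (hP : IsPrimitive P) {s t : A} (h : ∀ a : A, s * a * t ∈ P) : s ∈ P ∨ t ∈ P := by
  obtain ⟨H, _, _, _, π, ⟨⟨c, hc⟩, hirr⟩, rfl⟩ := hP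
  simp only [TwoSidedIdeal.mem_ker] at h ⊢
  by_contra hcon
  push Not at hcon
  obtain ⟨hs, ht⟩ := hcon
  obtain ⟨v, hv⟩ : ∃ v, π t v ≠ 0 := by
    by_contra! h0
    exact ht (ContinuousLinearMap.ext h0)
  -- two closed invariant subspaces: `π(A) w = 0`, and `π(s) π(A) w = 0`
  let N : Submodule ℂ H := ⨅ a : A, LinearMap.ker (π a : H →ₗ[ℂ] H)
  let M : Submodule ℂ H := ⨅ a : A, LinearMap.ker ((π s * π a : H →L[ℂ] H) : H →ₗ[ℂ] H)
  have memN : ∀ w, w ∈ N ↔ ∀ a, π a w = 0 := fun w => by simp [N, Submodule.mem_iInf]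
  have memM : ∀ w, w ∈ M ↔ ∀ a, π s (π a w) = 0 := fun w => by simp [M, Submodule.mem_iInf]
  have clN : IsClosed (N : Set H) := by
    have : (N : Set H) = ⋂ a : A, {w | π a w = 0} := by
      ext w; simp [memN]
    rw [this]
    exact isClosed_iInter fun a => isClosed_eq (π a).continuous continuous_const
  have clM : IsClosed (M : Set H) := by
    have : (M : Set H) = ⋂ a : A, {w | π s (π a w) = 0} := by
      ext w; simp [memM]
    rw [this]
    exact isClosed_iInter fun a =>
      isClosed_eq ((π s).continuous.comp (π a).continuous) continuous_const
  have hN : N = ⊥ := by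
    refine (hirr N clN fun a w hw => ?_).resolve_right fun hT => ?_
    · rw [(memN w).1 hw a]; exact N.zero_mem
    · refine hc (ContinuousLinearMap.ext fun w => ?_)
      exact (memN w).1 (hT ▸ Submodule.mem_top) c
  have hM : M = ⊤ := by
    refine (hirr M clM fun a w hw => ?_).resolve_left fun hB => ?_
    · refine (memM _).2 fun b => ?_
      have := (memM w).1 hw (b * a)
      simpa using this
    · have : π t v ∈ M := (memM _).2 fun a => by
        have := congrArg (fun T : H →L[ℂ] H => T v) (h a)
        simpa using this
      rw [hB] at this
      exact hv ((Submodule.mem_bot ℂ).1 this)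
  refine hs (ContinuousLinearMap.ext fun w => ?_)
  have hstar : ∀ (a : A) (x y : H), inner ℂ (π (star a) x) y = inner ℂ x (π a y) := fun a x y => by
    rw [map_star, ContinuousLinearMap.star_eq_adjoint, ContinuousLinearMap.adjoint_inner_left]
  have all : ∀ (a : A) (x : H), π s (π a x) = 0 := fun a x =>
    (memM x).1 (hM ▸ Submodule.mem_top) a
  have hz : ∀ x : H, π (star s) x = 0 := fun x => by
    have : π (star s) x ∈ N := (memN _).2 fun b => by
      rw [← inner_self_eq_zero (𝕜 := ℂ), ← star_star b, hstar, star_star, hstar, all,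
        inner_zero_right]
    rw [hN] at this
    exact (Submodule.mem_bot ℂ).1 this
  have : inner ℂ (π s w) (π s w) = (0 : ℂ) := by
    rw [← hstar, hz, inner_zero_left]
  simpa using this

/-- The hull-kernel topology on `Prim(A)`: the closed sets are exactly the hulls of ideals. -/
instance (A : Type u) [NonUnitalCStarAlgebra A] : TopologicalSpace (PrimSpace A) :=
  TopologicalSpace.ofClosed (Set.range (hull (A := A)))
    ⟨⊤, Set.eq_empty_of_forall_notMem fun P hP => P.2.ne_top (top_le_iff.1 hP)⟩
    (fun 𝒞 h𝒞 => ⟨sSup {I | hull I ∈ 𝒞}, by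
      ext P
      simp only [hull, Set.mem_ofPred_eq, Set.mem_sInter, sSup_le_iff]
      constructor
      · intro hP C hC
        obtain ⟨I, rfl⟩ := h𝒞 hC
        exact hP I hC
      · exact fun hP I hI => hP _ hI⟩)
    (by
      rintro _ ⟨I, rfl⟩ _ ⟨J, rfl⟩
      refine ⟨I ⊓ J, Set.ext fun P => ⟨fun hP => ?_, ?_⟩⟩
      · by_cases hI : I ≤ P.1
        · exact Or.inl hI
        · obtain ⟨s, hsI, hsP⟩ := Set.not_subset.1 hI
          refine Or.inr fun t htJ => (P.2.mem_or_mem fun a => hP ?_).resolve_left hsP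
          exact (TwoSidedIdeal.mem_inf A).2 ⟨I.mul_mem_right _ _ (I.mul_mem_right _ _ hsI),
            J.mul_mem_left _ _ htJ⟩
      · rintro (hP | hP)
        · exact le_trans inf_le_left (show I ≤ P.1 from hP)
        · exact le_trans inf_le_right (show J ≤ P.1 from hP))

theorem isClosed_iff_hull {A : Type u} [NonUnitalCStarAlgebra A] {C : Set (PrimSpace A)} :
    IsClosed C ↔ ∃ I : TwoSidedIdeal A, hull I = C := by
  rw [← isOpen_compl_iff]
  change Cᶜᶜ ∈ Set.range hull ↔ _
  rw [compl_compl, Set.mem_range]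

/-- `P₁ ≈ P₂` if `f(P₁) = f(P₂)` for all bounded continuous real functions `f` on `Prim(A)`. -/
def glimmSetoid (A : Type u) [NonUnitalCStarAlgebra A] : Setoid (PrimSpace A) where
  r P Q := ∀ f : PrimSpace A →ᵇ ℝ, f P = f Q
  iseqv := ⟨fun _ _ => rfl, fun h f => (h f).symm, fun h k f => (h f).trans (k f)⟩

/-- The set `Glimm(A)`, as the quotient `Prim(A)/≈`; a class is identified with the ideal
`Glimm.ideal` (see `Glimm.ideal_injective`). It carries no default topology. -/
def Glimm (A : Type u) [NonUnitalCStarAlgebra A] : Type u := Quotient (glimmSetoid A)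

/-- The quotient map `q_A : Prim(A) → Glimm(A)`. -/
def glimmMap (A : Type u) [NonUnitalCStarAlgebra A] : PrimSpace A → Glimm A :=
  Quotient.mk (glimmSetoid A)

/-- The Glimm ideal of a point of `Glimm(A)`: the kernel of the equivalence class. -/
def Glimm.ideal {A : Type u} [NonUnitalCStarAlgebra A] (G : Glimm A) : TwoSidedIdeal A :=
  kernel (glimmMap A ⁻¹' {G})

/-- The function on `Glimm(A)` to which a bounded continuous function on `Prim(A)` drops. -/
def Glimm.drop {A : Type u} [NonUnitalCStarAlgebra A] (f : PrimSpace A →ᵇ ℝ) : Glimm A → ℝ :=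
  Quotient.lift (s := glimmSetoid A) f (fun _ _ h => h f)

/-- The quotient topology `τ_q` on `Glimm(A)`. -/
@[reducible] def tauQ (A : Type u) [NonUnitalCStarAlgebra A] : TopologicalSpace (Glimm A) :=
  TopologicalSpace.coinduced (glimmMap A) inferInstance

/-- The weakest topology `τ_cr` on `Glimm(A)` that makes all the dropped functions continuous. -/
@[reducible] def tauCR (A : Type u) [NonUnitalCStarAlgebra A] : TopologicalSpace (Glimm A) :=
  ⨅ f : PrimSpace A →ᵇ ℝ, TopologicalSpace.induced (Glimm.drop f) inferInstance

/-- Equivalence classes are closed, so a point of `Glimm(A)` is determined by its ideal. -/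
theorem Glimm.ideal_injective {A : Type u} [NonUnitalCStarAlgebra A] :
    Function.Injective (Glimm.ideal (A := A)) := by
  intro G₁ G₂ h
  induction G₁ using Quotient.inductionOn with | _ P =>
  induction G₂ using Quotient.inductionOn with | _ Q =>
  have hcl : IsClosed {R : PrimSpace A | ∀ f : PrimSpace A →ᵇ ℝ, f R = f Q} := by
    simp only [Set.ofPred_forall]
    exact isClosed_iInter fun f => isClosed_eq f.continuous continuous_const
  obtain ⟨I, hI⟩ := isClosed_iff_hull.1 hcl
  refine Quotient.sound (s := glimmSetoid A) (?_ : P ∈ {R | ∀ f : PrimSpace A →ᵇ ℝ, f R = f Q})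
  rw [← hI]
  have h1 : I ≤ Glimm.ideal (Quotient.mk (glimmSetoid A) Q) := by
    refine le_sInf ?_
    rintro _ ⟨R, hR, rfl⟩
    have : R ∈ hull I := by
      rw [hI]; exact Quotient.exact (s := glimmSetoid A) hR
    exact this
  refine h1.trans (h ▸ sInf_le ⟨P, rfl, rfl⟩)

/-- The norm `‖a + I‖` of the image of `a` in the quotient `A / I`. -/
noncomputable def quotientNorm {A : Type u} [NonUnitalCStarAlgebra A] (a : A)
    (I : TwoSidedIdeal A) : ℝ :=
  ‖(QuotientAddGroup.mk a : A ⧸ AddSubgroup.ofClass I)‖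

/-- `P ∼ Q`: the points `P`, `Q` of `Prim(A)` cannot be separated by disjoint open sets. -/
def NotSeparated {A : Type u} [NonUnitalCStarAlgebra A] (P Q : PrimSpace A) : Prop :=
  ∀ U V : Set (PrimSpace A), IsOpen U → IsOpen V → P ∈ U → Q ∈ V → (U ∩ V).Nonempty

/-- `A` is quasi-standard if `∼` is an open equivalence relation on `Prim(A)`, that is, an
equivalence relation for which the saturation of every open set is open. -/
def IsQuasiStandard (A : Type u) [NonUnitalCStarAlgebra A] : Prop :=
  Equivalence (NotSeparated (A := A)) ∧
    ∀ U : Set (PrimSpace A), IsOpen U → IsOpen {Q | ∃ P ∈ U, NotSeparated P Q}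

end CStarGlimm

namespace CStarGlimm

universe u

open Filter Topology
open scoped ComplexOrder

/-! `Prim(A)` is locally compact, although in general not Hausdorff: the open set `‖b + P‖ > 1` lies
in the compact set `‖b + P‖ ≥ 1`. Compactness (`isCompact_normGeOne`) comes from quasi-states. An
ultralimit of quasi-states is a quasi-state, and Krein–Milman together with GNS turns it into one
that vanishes on a primitive ideal.

If `q_A` is open, `(Glimm(A), τ_q)` inherits local compactness, and it is Hausdorff because the
dropped functions separate points. It is therefore completely regular, so `q_A` maps open sets to
`τ_cr`-open sets. The images of the sets `‖b + P‖ > 1` then cover `K`, finitely many `b` suffice,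
and `a = ∑ b* b` works with `α = 1`: a quasi-state large on one summand is nonnegative on the
others.

For quasi-standard `A`, the same separation argument applied to `∼` shows that bounded continuous
functions distinguish `∼`-classes. Hence `∼` equals `≈`, and openness of `∼` is openness of `q_A`.
-/

/-- The positive linear functionals of norm at most one (in the form `|f a|² ≤ f (a* a)`) that
vanish on `J`, as a subset of `A → ℂ` with the topology of pointwise convergence. -/
def quasiStates {A : Type u} [NonUnitalCStarAlgebra A] (J : TwoSidedIdeal A) : Set (A → ℂ) :=
  {f | (∀ a b, f (a + b) = f a + f b) ∧ (∀ (c : ℂ) a, f (c • a) = c * f a) ∧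
    (∀ a, ‖f a‖ ≤ ‖a‖) ∧ (∀ a, ‖f a‖ ^ 2 ≤ (f (star a * a)).re) ∧
    (∀ a, (f (star a * a)).im = 0) ∧ ∀ x ∈ J, f x = 0}

/-! ### Quasi-states, GNS and compact subsets of `Prim(A)` -/

section quasiStates

variable {A : Type u} [NonUnitalCStarAlgebra A] {J : TwoSidedIdeal A}

theorem quasiStates_anti {I : TwoSidedIdeal A} (h : I ≤ J) : quasiStates J ⊆ quasiStates I :=
  fun _ hf => ⟨hf.1, hf.2.1, hf.2.2.1, hf.2.2.2.1, hf.2.2.2.2.1, fun x hx => hf.2.2.2.2.2 x (h hx)⟩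

theorem isClosed_quasiStates (J : TwoSidedIdeal A) : IsClosed (quasiStates J) := by
  simp only [quasiStates, Set.ofPred_and, Set.ofPred_forall]
  refine IsClosed.inter ?_ (IsClosed.inter ?_ (IsClosed.inter ?_ (IsClosed.inter ?_
    (IsClosed.inter ?_ ?_))))
  · exact isClosed_iInter fun a => isClosed_iInter fun b => isClosed_eq (by fun_prop) (by fun_prop)
  · exact isClosed_iInter fun a => isClosed_iInter fun b => isClosed_eq (by fun_prop) (by fun_prop)
  · exact isClosed_iInter fun a => isClosed_le (by fun_prop) (by fun_prop)
  · exact isClosed_iInter fun a => isClosed_le (by fun_prop)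
      (Complex.continuous_re.comp (continuous_apply _))
  · exact isClosed_iInter fun a => isClosed_eq
      (Complex.continuous_im.comp (continuous_apply _)) continuous_const
  · exact isClosed_iInter fun a => isClosed_iInter fun _ => isClosed_eq (by fun_prop) (by fun_prop)

theorem isCompact_quasiStates (J : TwoSidedIdeal A) : IsCompact (quasiStates J) := by
  refine (isCompact_univ_pi fun a : A => isCompact_closedBall (0 : ℂ) ‖a‖).of_isClosed_subset
    (isClosed_quasiStates J) fun f hf a _ => ?_
  simpa using hf.2.2.1 a

theorem inner_rep_star {H : Type*} [NormedAddCommGroup H] [InnerProductSpace ℂ H] [CompleteSpace H]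
    (π : A →⋆ₙₐ[ℂ] (H →L[ℂ] H)) (a : A) (x y : H) :
    inner ℂ x (π (star a) y) = inner ℂ (π a x) y := by
  rw [map_star, ContinuousLinearMap.star_eq_adjoint, ContinuousLinearMap.adjoint_inner_right]

theorem inner_rep_star_mul_self {H : Type*} [NormedAddCommGroup H] [InnerProductSpace ℂ H]
    [CompleteSpace H] (π : A →⋆ₙₐ[ℂ] (H →L[ℂ] H)) (a : A) (v : H) :
    inner ℂ v (π (star a * a) v) = ((‖π a v‖ ^ 2 : ℝ) : ℂ) := by
  rw [map_mul, mul_apply_eq_comp, inner_rep_star, inner_self_eq_norm_sq_to_K]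
  norm_cast

theorem vectorState_mem {H : Type*} [NormedAddCommGroup H] [InnerProductSpace ℂ H]
    [CompleteSpace H] (π : A →⋆ₙₐ[ℂ] (H →L[ℂ] H)) (hJ : ∀ x ∈ J, π x = 0) {v : H}
    (hv : ‖v‖ ≤ 1) : (fun a => inner ℂ v (π a v)) ∈ quasiStates J := by
  refine ⟨fun a b => by simp, fun c a => by simp,
    fun a => ?_, fun a => ?_, fun a => ?_, fun x hx => by simp [hJ x hx]⟩
  · calc ‖inner ℂ v (π a v)‖ ≤ ‖v‖ * ‖π a v‖ := norm_inner_le_norm _ _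
      _ ≤ 1 * (‖a‖ * 1) := by
        gcongr
        refine ((π a).le_opNorm v).trans ?_
        gcongr
        exact NonUnitalStarAlgHom.norm_apply_le π a
      _ = ‖a‖ := by ring
  · beta_reduce
    rw [inner_rep_star_mul_self, Complex.ofReal_re]
    gcongr
    refine (norm_inner_le_norm v (π a v)).trans ?_
    exact mul_le_of_le_one_left (norm_nonneg _) hv
  · beta_reduce
    rw [inner_rep_star_mul_self, Complex.ofReal_im]

/-- A quasi-state is a vector state of a cyclic representation. -/
theorem exists_cyclic_rep {f : A → ℂ} (hf : f ∈ quasiStates J) :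
    ∃ (H : Type u) (_ : NormedAddCommGroup H) (_ : InnerProductSpace ℂ H) (_ : CompleteSpace H)
      (π : A →⋆ₙₐ[ℂ] (H →L[ℂ] H)) (ξ : H), ‖ξ‖ ≤ 1 ∧ (∀ a, f a = inner ℂ ξ (π a ξ)) ∧
        Dense (Set.range fun a => π a ξ) ∧ ∀ x ∈ J, π x = 0 := by
  obtain ⟨hadd, hsmul, -, hsq, him, hJ⟩ := hf
  let _ : PartialOrder A := CStarAlgebra.spectralOrder A
  have : StarOrderedRing A := CStarAlgebra.spectralOrderedRing A
  let l : A →ₗ[ℂ] ℂ := { toFun := f, map_add' := hadd, map_smul' := fun c a => hsmul c a }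
  let φ : A →ₚ[ℂ] ℂ := PositiveLinearMap.mk₀ l fun a ha => by
    obtain ⟨b, rfl⟩ := CStarAlgebra.nonneg_iff_eq_star_mul_self.1 ha
    exact Complex.nonneg_iff.2 ⟨(sq_nonneg _).trans (hsq b), (him b).symm⟩
  have hφ : ∀ a, φ a = f a := fun _ => rfl
  -- The bound `|f a|² ≤ f (a* a)` makes `f` contractive for the GNS seminorm, so Riesz
  -- representation on the completion yields the cyclic vector without a unit or an approximate
  -- unit.
  let l₀ : φ.PreGNS →L[ℂ] ℂ := LinearMap.mkContinuous (l ∘ₗ φ.ofPreGNS.toLinearMap) 1 fun a => by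
    rw [one_mul, φ.preGNS_norm_def]
    exact Real.le_sqrt_of_sq_le (hsq _)
  let L : φ.GNS →L[ℂ] ℂ := l₀.extend (UniformSpace.Completion.toComplL (𝕜 := ℂ) (E := φ.PreGNS))
  have hL : ∀ a : φ.PreGNS, L a = f (φ.ofPreGNS a) := fun a => by
    refine ContinuousLinearMap.extend_eq l₀ ?_ ?_ a
    · exact UniformSpace.Completion.denseRange_coe
    · exact UniformSpace.Completion.isUniformInducing_coe _
  let ξ : φ.GNS := (InnerProductSpace.toDual ℂ φ.GNS).symm L
  have hξ : ∀ x, inner ℂ ξ x = L x := fun x => InnerProductSpace.toDual_symm_apply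
  have hcyc : ∀ a : A, φ.gnsNonUnitalStarAlgHom a ξ = (φ.toPreGNS a : φ.GNS) := fun a => by
    refine ext_inner_right ℂ fun y => ?_
    induction y using UniformSpace.Completion.induction_on with
    | hp => apply isClosed_eq <;> fun_prop
    | ih y =>
      rw [← inner_rep_star, hξ, φ.gnsNonUnitalStarAlgHom_apply_coe, hL,
        UniformSpace.Completion.inner_coe, φ.preGNS_inner_def]
      rfl
  refine ⟨φ.GNS, inferInstance, inferInstance, inferInstance, φ.gnsNonUnitalStarAlgHom, ξ,
    ?_, fun a => ?_, ?_, fun x hx => ?_⟩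
  · rw [LinearIsometryEquiv.norm_map]
    refine ContinuousLinearMap.opNorm_le_bound _ zero_le_one fun y => ?_
    induction y using UniformSpace.Completion.induction_on with
    | hp => apply isClosed_le <;> fun_prop
    | ih y =>
      rw [hL, one_mul, UniformSpace.Completion.norm_coe, φ.preGNS_norm_def]
      exact Real.le_sqrt_of_sq_le (hsq _)
  · rw [hcyc, hξ, hL]; rfl
  · simp only [hcyc]
    exact UniformSpace.Completion.denseRange_coe (α := φ.PreGNS)
  · ext y
    induction y using UniformSpace.Completion.induction_on with
    | hp => apply isClosed_eq <;> fun_prop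
    | ih y =>
      rw [φ.gnsNonUnitalStarAlgHom_apply_coe, zero_apply, ← norm_eq_zero,
        UniformSpace.Completion.norm_coe, φ.preGNS_norm_def, hφ, hJ]
      · simp
      · exact J.mul_mem_left _ _ (J.mul_mem_right _ _ hx)

/-- An invariant `M` splits `ξ = v + w` along `M` and `Mᗮ`, which writes the state as a convex
combination of rescaled vector states of `v` and `w`. If both are nonzero, extremality makes `v` a
multiple of `ξ`, and this forces `v ∈ M ∩ Mᗮ`. -/
theorem isIrreducibleRep_of_mem_extremePoints {H : Type u} [NormedAddCommGroup H]
    [InnerProductSpace ℂ H] [CompleteSpace H] {π : A →⋆ₙₐ[ℂ] (H →L[ℂ] H)} {ξ : H}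
    (hJ : ∀ x ∈ J, π x = 0) (hξ : ‖ξ‖ ≤ 1) (hcyc : Dense (Set.range fun a => π a ξ))
    (hext : (fun a => inner ℂ ξ (π a ξ)) ∈ (quasiStates J).extremePoints ℝ)
    (hne : ∃ a, π a ≠ 0) : IsIrreducibleRep π := by
  refine ⟨hne, fun M hMc hM => ?_⟩
  have : CompleteSpace M := hMc.completeSpace_coe
  have hM' : ∀ a : A, ∀ v ∈ Mᗮ, π a v ∈ Mᗮ := fun a v hv => by
    refine (Submodule.mem_orthogonal _ _).2 fun m hm => ?_
    rw [← star_star a, inner_rep_star]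
    exact (Submodule.mem_orthogonal _ _).1 hv _ (hM _ _ hm)
  have top_of_mem : ∀ N : Submodule ℂ H, IsClosed (N : Set H) → (∀ a : A, ∀ v ∈ N, π a v ∈ N) →
      ξ ∈ N → N = ⊤ := fun N hNc hN hξN => by
    refine Submodule.eq_top_iff'.2 fun x => ?_
    exact closure_minimal (Set.range_subset_iff.2 fun a => hN a ξ hξN) hNc (hcyc x)
  obtain ⟨v, hv, w, hw, hvw⟩ := M.exists_add_mem_mem_orthogonal ξ
  by_cases hv0 : v = 0
  · left
    rw [hv0, zero_add] at hvw
    rw [← Submodule.orthogonal_eq_top_iff]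
    exact top_of_mem _ M.isClosed_orthogonal hM' (hvw ▸ hw)
  by_cases hw0 : w = 0
  · right
    rw [hw0, add_zero] at hvw
    exact top_of_mem _ hMc hM (hvw ▸ hv)
  exfalso
  have hperp : ∀ x ∈ M, ∀ y ∈ Mᗮ, inner ℂ x y = 0 := fun x hx y hy =>
    (Submodule.mem_orthogonal _ _).1 hy x hx
  have hperp' : ∀ x ∈ M, ∀ y ∈ Mᗮ, inner ℂ y x = 0 := fun x hx y hy =>
    (Submodule.mem_orthogonal' _ _).1 hy x hx
  have hnorm : ‖v‖ ^ 2 + ‖w‖ ^ 2 ≤ 1 := by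
    have h := norm_add_sq_eq_norm_sq_add_norm_sq_of_inner_eq_zero v w (hperp v hv w hw)
    rw [← hvw] at h
    nlinarith [norm_nonneg ξ]
  have hvpos : 0 < ‖v‖ := norm_pos_iff.2 hv0
  have hwpos : 0 < ‖w‖ := norm_pos_iff.2 hw0
  -- The weights are `t` and `1 - t`, not `‖w‖²`. Since `‖ξ‖` may be below 1, only `‖w‖² ≤ 1 - t`
  -- holds, which is enough for quasi-states.
  set t : ℝ := ‖v‖ ^ 2 with ht
  have htpos : 0 < t := by positivity
  have hspos : 0 < 1 - t := by have : 0 < ‖w‖ ^ 2 := by positivity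
                               linarith
  have scaled : ∀ (x : H) (r : ℝ), 0 < r → ‖x‖ ^ 2 ≤ r →
      ∃ g ∈ quasiStates J, ∀ a, (r : ℂ) * g a = inner ℂ x (π a x) := fun x r hr hx => by
    have hr' : (Real.sqrt r : ℂ) ≠ 0 := by exact_mod_cast (Real.sqrt_pos.2 hr).ne'
    refine ⟨_, vectorState_mem π hJ (v := ((Real.sqrt r : ℂ)⁻¹ • x)) ?_, fun a => ?_⟩
    · rw [norm_smul, norm_inv, Complex.norm_real, Real.norm_of_nonneg (Real.sqrt_nonneg r),
        inv_mul_le_one₀ (Real.sqrt_pos.2 hr)]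
      exact Real.le_sqrt_of_sq_le hx
    · have h2 : (r : ℂ) = Real.sqrt r * Real.sqrt r := by
        exact_mod_cast (Real.mul_self_sqrt hr.le).symm
      rw [map_smul, inner_smul_left, inner_smul_right, h2, map_inv₀, Complex.conj_ofReal]
      field_simp
  obtain ⟨g₁, hg₁, h₁⟩ := scaled v t htpos le_rfl
  obtain ⟨g₂, hg₂, h₂⟩ := scaled w (1 - t) hspos (by linarith)
  have hsum : ∀ a, inner ℂ ξ (π a ξ) = inner ℂ v (π a v) + inner ℂ w (π a w) := fun a => by
    rw [hvw, map_add, inner_add_left, inner_add_right, inner_add_right,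
      hperp v hv _ (hM' a w hw), hperp' _ (hM a v hv) w hw, add_zero, zero_add]
  have hseg : g₁ = fun a => inner ℂ ξ (π a ξ) := by
    refine (mem_extremePoints_iff_left.1 hext).2 g₁ hg₁ g₂ hg₂
      ⟨t, 1 - t, htpos, hspos, by ring, funext fun a => ?_⟩
    rw [hsum, ← h₁, ← h₂]
    simp
  -- Extremality gives `⟪v, π a ξ⟫ = t ⟪ξ, π a ξ⟫` for all `a`, and the vectors `π a ξ` are dense.
  have hzero : v - (t : ℂ) • ξ = 0 := by
    have hc : Continuous fun y : H => inner ℂ (v - (t : ℂ) • ξ) y := by fun_prop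
    have h0 : (fun y : H => inner ℂ (v - (t : ℂ) • ξ) y) = fun _ => (0 : ℂ) := by
      refine Continuous.ext_on hcyc hc continuous_const ?_
      rintro _ ⟨a, rfl⟩
      have h := h₁ a
      rw [hseg] at h
      have h' : inner ℂ v (π a ξ) = inner ℂ v (π a v) := by
        rw [hvw, map_add, inner_add_right, hperp v hv _ (hM' a w hw), add_zero]
      simp only [inner_sub_left, inner_smul_left, Complex.conj_ofReal]
      rw [h', ← h, sub_self]
    exact inner_self_eq_zero.1 (congrFun h0 (v - (t : ℂ) • ξ))
  have hw1 : w = ((1 - t : ℝ) : ℂ) • ξ := by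
    have : w - ((1 - t : ℝ) : ℂ) • ξ = -(v - (t : ℂ) • ξ) := by
      rw [hvw]
      push_cast
      module
    rwa [hzero, neg_zero, sub_eq_zero] at this
  have hξM : ξ ∈ Mᗮ := by
    have : ξ = ((1 - t : ℝ) : ℂ)⁻¹ • w := by
      rw [hw1, smul_smul, inv_mul_cancel₀ (by exact_mod_cast hspos.ne'), one_smul]
    rw [this]
    exact Mᗮ.smul_mem _ hw
  have hvM : v ∈ Mᗮ := by
    rw [sub_eq_zero.1 hzero]
    exact Mᗮ.smul_mem _ hξM
  exact hv0 (inner_self_eq_zero.1 (hperp v hv v hvM))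

/-- The value of a quasi-state killing `J` at `b* b` is dominated by that of a quasi-state killing
some primitive ideal that contains `J`. -/
theorem exists_primitive_quasiState {f : A → ℂ} (hf : f ∈ quasiStates J) {b : A}
    (hb : 1 ≤ (f (star b * b)).re) :
    ∃ P : PrimSpace A, J ≤ P.1 ∧ ∃ g ∈ quasiStates P.1, 1 ≤ (g (star b * b)).re := by
  let ev : (A → ℂ) →L[ℝ] ℝ :=
    Complex.reCLM.comp (ContinuousLinearMap.proj (R := ℝ) (φ := fun _ : A => ℂ) (star b * b))
  have hev : ∀ g, ev g = (g (star b * b)).re := fun _ => rfl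
  -- The maximisers of `g ↦ re g(b* b)` form a compact exposed face, so an extreme point of it is
  -- extreme among all quasi-states and still has value at least 1.
  have hexp : IsExposed ℝ (quasiStates J) (ev.toExposed (quasiStates J)) :=
    ContinuousLinearMap.toExposed.isExposed
  obtain ⟨m, hm, hmax⟩ := (isCompact_quasiStates J).exists_isMaxOn ⟨f, hf⟩ ev.continuous.continuousOn
  obtain ⟨g, hg⟩ := (hexp.isCompact (isCompact_quasiStates J)).extremePoints_nonempty
    ⟨m, hm, fun y hy => hmax hy⟩
  have hgJ := hexp.isExtreme.extremePoints_subset_extremePoints hg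
  have hgb : 1 ≤ (g (star b * b)).re := hb.trans ((extremePoints_subset hg).2 f hf)
  obtain ⟨H, _, _, _, π, ξ, hξ, hgξ, hcyc, hπJ⟩ := exists_cyclic_rep (extremePoints_subset hgJ)
  obtain rfl : g = fun a => inner ℂ ξ (π a ξ) := funext hgξ
  have hirr : IsIrreducibleRep π := by
    refine isIrreducibleRep_of_mem_extremePoints hπJ hξ hcyc hgJ ⟨star b * b, fun h => ?_⟩
    simp only [h, zero_apply, inner_zero_right, Complex.zero_re] at hgb
    linarith
  exact ⟨⟨TwoSidedIdeal.ker π, H, _, _, _, π, hirr, rfl⟩,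
    fun x hx => (TwoSidedIdeal.mem_ker π).2 (hπJ x hx), _,
    vectorState_mem π (fun x hx => (TwoSidedIdeal.mem_ker π).1 hx) hξ, hgb⟩

/-- The primitive ideals `P` with `‖b + P‖ ≥ 1`, expressed by quasi-states. -/
def normGeOne (b : A) : Set (PrimSpace A) :=
  {P | ∃ f ∈ quasiStates P.1, 1 ≤ (f (star b * b)).re}

/-- The ideal of the elements that eventually lie in `P` as `P` runs along a filter. -/
def eventualIdeal (l : Filter (PrimSpace A)) : TwoSidedIdeal A :=
  .mk' {x | ∀ᶠ P in l, x ∈ P.1} (by simp)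
    (fun hx hy => by filter_upwards [hx, hy] with P h h' using P.1.add_mem h h')
    (fun hx => by filter_upwards [hx] with P h using P.1.neg_mem h)
    (fun hx => by filter_upwards [hx] with P h using P.1.mul_mem_left _ _ h)
    (fun hx => by filter_upwards [hx] with P h using P.1.mul_mem_right _ _ h)

theorem mem_eventualIdeal {l : Filter (PrimSpace A)} {x : A} :
    x ∈ eventualIdeal l ↔ ∀ᶠ P in l, x ∈ P.1 :=
  TwoSidedIdeal.mem_mk' _ _ _ _ _ _ _

/-- If a closed set `hull I` belongs to `l`, every element of `I` is eventually in the ideals, so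
`I` lies in `P` and `P` is in that closed set. -/
theorem ultrafilter_le_nhds {l : Ultrafilter (PrimSpace A)} {P : PrimSpace A}
    (h : eventualIdeal (l : Filter (PrimSpace A)) ≤ P.1) : (l : Filter (PrimSpace A)) ≤ 𝓝 P := by
  refine le_nhds_iff.2 fun U hPU hU => ?_
  by_contra hUl
  obtain ⟨I, hI⟩ := isClosed_iff_hull.1 hU.isClosed_compl
  have hmem : hull I ∈ l := hI ▸ Ultrafilter.compl_mem_iff_notMem.2 hUl
  have hP : P ∈ hull I := le_trans (fun x hx => mem_eventualIdeal.2 <| by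
    filter_upwards [hmem] with Q hQ using hQ hx) h
  exact (hI ▸ hP : P ∈ Uᶜ) hPU

/-- Along an ultrafilter the witnessing quasi-states converge pointwise to one that kills
`eventualIdeal`. A primitive ideal above it carrying a large quasi-state is the required limit
point. -/
theorem isCompact_normGeOne (b : A) : IsCompact (normGeOne b) := by
  refine isCompact_iff_ultrafilter_le_nhds'.2 fun l hl => ?_
  -- The value 0 off `normGeOne b` is never seen, since `l` contains that set.
  have hch : ∀ P : PrimSpace A, ∃ f : A → ℂ,
      P ∈ normGeOne b → f ∈ quasiStates P.1 ∧ 1 ≤ (f (star b * b)).re := fun P => by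
    by_cases hP : P ∈ normGeOne b
    · obtain ⟨f, hf⟩ := hP
      exact ⟨f, fun _ => hf⟩
    · exact ⟨0, fun h => (hP h).elim⟩
  choose F hF using hch
  have hlF : ∀ᶠ P in l, F P ∈ quasiStates P.1 ∧ 1 ≤ (F P (star b * b)).re := by
    filter_upwards [hl] with P hP using hF P hP
  obtain ⟨f, hf, hlim⟩ := (isCompact_quasiStates (⊥ : TwoSidedIdeal A)).ultrafilter_le_nhds'
    (l.map F) (hlF.mono fun P hP => quasiStates_anti bot_le hP.1)
  have hlim' : ∀ a, Tendsto (fun P => F P a) l (𝓝 (f a)) := tendsto_pi_nhds.1 hlim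
  have hfJ : f ∈ quasiStates (eventualIdeal (l : Filter (PrimSpace A))) :=
    ⟨hf.1, hf.2.1, hf.2.2.1, hf.2.2.2.1, hf.2.2.2.2.1, fun x hx =>
      tendsto_nhds_unique_of_eventuallyEq (hlim' x) tendsto_const_nhds <| by
        filter_upwards [hlF, mem_eventualIdeal.1 hx] with P hP hxP using hP.1.2.2.2.2.2 x hxP⟩
  have hfb : 1 ≤ (f (star b * b)).re :=
    ge_of_tendsto ((Complex.continuous_re.tendsto _).comp (hlim' (star b * b)))
      (hlF.mono fun P hP => hP.2)
  obtain ⟨P, hJP, hP⟩ := exists_primitive_quasiState hfJ hfb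
  exact ⟨P, hP, ultrafilter_le_nhds hJP⟩

end quasiStates

/-! ### Local compactness of `Prim(A)` -/

section locallyCompact

variable {A : Type u} [NonUnitalCStarAlgebra A]

theorem isOpen_notMem (x : A) : IsOpen {P : PrimSpace A | x ∉ P.1} := by
  rw [← isClosed_compl_iff, isClosed_iff_hull]
  refine ⟨TwoSidedIdeal.span {x}, Set.ext fun P => ?_⟩
  simp [hull, TwoSidedIdeal.span_le]

/-- The primitive ideals `P` with `‖b* b + P‖ > 1`, expressed by functional calculus. -/
def normGtOne (b : A) : Set (PrimSpace A) :=
  {P | cfcₙ (fun x : ℝ => max (|x| - 1) 0) (star b * b) ∉ P.1}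

/-- Both sides say that the spectrum of `h` lies in `[-1, 1]`. -/
theorem cfcₙ_max_abs_sub_one_eq_zero_iff {B : Type*} [NonUnitalCStarAlgebra B] {h : B}
    (hh : IsSelfAdjoint h) : cfcₙ (fun x : ℝ => max (|x| - 1) 0) h = 0 ↔ ‖h‖ ≤ 1 := by
  rw [← norm_le_zero_iff, norm_cfcₙ_le_iff (fun x : ℝ => max (|x| - 1) 0) h 0]
  nth_rw 2 [← cfcₙ_id' ℝ h]
  rw [norm_cfcₙ_le_iff (fun x : ℝ => x) h 1]
  refine forall₂_congr fun x _ => ?_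
  rw [Real.norm_eq_abs, Real.norm_eq_abs, abs_of_nonneg (le_max_right _ _)]
  simp

/-- Functional calculus commutes with `π`, so a norm condition on `π b` becomes non-membership of
one fixed element of `A` in `P`. This is what makes `normGtOne b` open. -/
theorem mem_normGtOne_iff {H : Type u} [NormedAddCommGroup H] [InnerProductSpace ℂ H]
    [CompleteSpace H] {π : A →⋆ₙₐ[ℂ] (H →L[ℂ] H)} {P : PrimSpace A}
    (hP : P.1 = TwoSidedIdeal.ker π) {b : A} : P ∈ normGtOne b ↔ 1 < ‖π b‖ := by
  have hcont : Continuous π := AddMonoidHomClass.continuous_of_bound π 1 fun a => by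
    rw [one_mul]
    exact NonUnitalStarAlgHom.norm_apply_le π a
  have hmap := NonUnitalStarAlgHom.map_cfcₙ (R := ℝ) π (fun x : ℝ => max (|x| - 1) 0) (star b * b)
    (hφa := (IsSelfAdjoint.star_mul_self b).map π)
  rw [normGtOne, Set.mem_ofPred_eq, hP, TwoSidedIdeal.mem_ker, hmap,
    cfcₙ_max_abs_sub_one_eq_zero_iff ((IsSelfAdjoint.star_mul_self b).map π), map_mul, map_star,
    CStarRing.norm_star_mul_self, not_le, ← sq, one_lt_sq_iff₀ (norm_nonneg _)]

theorem isOpen_normGtOne (b : A) : IsOpen (normGtOne b) := isOpen_notMem _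

/-- If `‖π b‖ > 1`, some unit vector `v` has `‖π b v‖ > 1`, and its vector state is the witness. -/
theorem normGtOne_subset (b : A) : normGtOne b ⊆ normGeOne b := fun P hP => by
  obtain ⟨H, _, _, _, π, -, hker⟩ := P.2
  rw [mem_normGtOne_iff hker] at hP
  by_contra hcon
  refine hP.not_ge (ContinuousLinearMap.opNorm_le_of_unit_norm zero_le_one fun v hv => ?_)
  by_contra! hlt
  refine hcon ⟨_, vectorState_mem π (fun x hx => ?_) hv.le, ?_⟩
  · exact (TwoSidedIdeal.mem_ker π).1 (hker ▸ hx)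
  · rw [inner_rep_star_mul_self, Complex.ofReal_re]
    exact one_le_pow₀ hlt.le

theorem exists_mem_normGtOne (P : PrimSpace A) : ∃ b, P ∈ normGtOne b := by
  obtain ⟨H, _, _, _, π, ⟨⟨c, hc⟩, -⟩, hker⟩ := P.2
  refine ⟨((2 / ‖π c‖ : ℝ) : ℂ) • c, (mem_normGtOne_iff hker).2 ?_⟩
  have : ‖π c‖ ≠ 0 := norm_ne_zero_iff.2 hc
  rw [map_smul, norm_smul, Complex.norm_real, norm_div, norm_norm, div_mul_cancel₀ _ this]
  norm_num

instance : WeaklyLocallyCompactSpace (PrimSpace A) where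
  exists_compact_mem_nhds P := by
    obtain ⟨b, hb⟩ := exists_mem_normGtOne P
    exact ⟨normGeOne b, isCompact_normGeOne b,
      mem_of_superset ((isOpen_normGtOne b).mem_nhds hb) (normGtOne_subset b)⟩

/-- A contractive functional that kills `I` takes the same value on the whole coset `a + I`, so it
bounds every norm there from below. -/
theorem one_le_quotientNorm {I : TwoSidedIdeal A} {f : A → ℂ} (hf : f ∈ quasiStates I) {a : A}
    (ha : 1 ≤ (f a).re) : 1 ≤ quotientNorm a I := by
  rw [quotientNorm, QuotientAddGroup.norm_mk, Metric.le_infDist ⟨0, zero_mem _⟩]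
  intro x hx
  obtain ⟨hadd, hsmul, hle, -, -, hI⟩ := hf
  have hsub : f (a - x) = f a := by
    have := hadd (a - x) x
    rwa [sub_add_cancel, hI x hx, add_zero, eq_comm] at this
  calc (1 : ℝ) ≤ (f a).re := ha
    _ ≤ ‖f a‖ := Complex.re_le_norm _
    _ = ‖f (a - x)‖ := by rw [hsub]
    _ ≤ ‖a - x‖ := hle _
    _ = dist a x := (dist_eq_norm a x).symm

end locallyCompact

/-! ### Urysohn separation for open equivalence relations -/

section topology

/-- The classes of an open equivalence relation `r` such that `r`-inequivalent points have disjoint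
neighbourhoods are separated by continuous functions, if the space is locally compact. -/
theorem exists_continuous_separating {X : Type*} [TopologicalSpace X] [WeaklyLocallyCompactSpace X]
    (r : Setoid X) (hopen : ∀ U : Set X, IsOpen U → IsOpen {y | ∃ x ∈ U, r x y})
    (hsep : ∀ x y, ¬ r x y → ∃ U V : Set X, IsOpen U ∧ IsOpen V ∧ x ∈ U ∧ y ∈ V ∧
      ∀ u ∈ U, ∀ v ∈ V, ¬ r u v) {x : X} {U : Set X} (hU : IsOpen U)
    (hUr : ∀ u ∈ U, ∀ v, r u v → v ∈ U) (hx : x ∈ U) :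
    ∃ f : X →ᵇ ℝ, f x = 0 ∧ (∀ u v, r u v → f u = f v) ∧ ∀ y ∉ U, f y = 1 := by
  have hq : IsOpenQuotientMap (Quotient.mk r) := by
    refine ⟨Quotient.mk_surjective, continuous_quotient_mk', fun V hV => ?_⟩
    rw [← isQuotientMap_quotient_mk'.isOpen_preimage]
    convert hopen V hV using 1
    ext y
    simp only [Set.mem_preimage, Set.mem_image, Set.mem_ofPred_eq]
    exact exists_congr fun z => and_congr_right fun _ => Quotient.eq
  -- The quotient is locally compact because the quotient map is open, and Hausdorff by `hsep`, so
  -- Urysohn's lemma applies there to a point and a closed set.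
  have : WeaklyLocallyCompactSpace (Quotient r) := hq.weaklyLocallyCompactSpace
  have : T2Space (Quotient r) := by
    refine ⟨fun a b hab => ?_⟩
    induction a using Quotient.inductionOn with | _ y =>
    induction b using Quotient.inductionOn with | _ z =>
    obtain ⟨V, W, hV, hW, hyV, hzW, h⟩ := hsep y z fun h => hab (Quotient.sound h)
    refine ⟨_, _, hq.isOpenMap V hV, hq.isOpenMap W hW, ⟨y, hyV, rfl⟩, ⟨z, hzW, rfl⟩, ?_⟩
    rw [Set.disjoint_left]
    rintro _ ⟨v, hv, rfl⟩ ⟨w, hw, hvw⟩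
    exact h v hv w hw (r.symm (Quotient.exact hvw))
  obtain ⟨g, hg0, hg1, hg⟩ := exists_continuous_zero_one_of_isCompact
    (isCompact_singleton (x := (Quotient.mk r x))) (hq.isOpenMap U hU).isClosed_compl (by
      rw [Set.disjoint_singleton_left]
      exact fun h => h ⟨x, hx, rfl⟩)
  refine ⟨BoundedContinuousFunction.ofNormedAddCommGroup (fun y => g (Quotient.mk r y))
    (g.continuous.comp hq.continuous) 1 fun y => ?_, hg0 rfl, fun u v huv => ?_, fun y hy => hg1 ?_⟩
  · rw [Real.norm_of_nonneg (hg _).1]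
    exact (hg _).2
  · exact congrArg g (Quotient.sound huv)
  · rintro ⟨z, hz, hzy⟩
    exact hy (hUr z hz y (Quotient.exact hzy))

end topology

/-! ### The topologies on `Glimm(A)` and the two assertions -/

section Glimm

variable {A : Type u} [NonUnitalCStarAlgebra A]

theorem isOpenMap_glimmMap_iff :
    @IsOpenMap (PrimSpace A) (Glimm A) inferInstance (tauQ A) (glimmMap A) ↔
      ∀ U : Set (PrimSpace A), IsOpen U → IsOpen {Q | ∃ P ∈ U, glimmSetoid A P Q} := by
  refine forall₂_congr fun U _ => ?_
  rw [isOpen_coinduced]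
  have : glimmMap A ⁻¹' (glimmMap A '' U) = {Q | ∃ P ∈ U, glimmSetoid A P Q} := by
    ext Q
    exact exists_congr fun P => and_congr_right fun _ => Quotient.eq
  rw [this]

/-- The dropped functions separate the points of `Glimm(A)`. -/
theorem exists_open_separating_of_not_glimm {P Q : PrimSpace A} (h : ¬ glimmSetoid A P Q) :
    ∃ U V : Set (PrimSpace A), IsOpen U ∧ IsOpen V ∧ P ∈ U ∧ Q ∈ V ∧
      ∀ u ∈ U, ∀ v ∈ V, ¬ glimmSetoid A u v := by
  obtain ⟨f, hf⟩ := not_forall.1 h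
  obtain ⟨S, T, hS, hT, hPS, hQT, hST⟩ := t2_separation hf
  exact ⟨f ⁻¹' S, f ⁻¹' T, hS.preimage f.continuous, hT.preimage f.continuous, hPS, hQT,
    fun u hu v hv huv => Set.disjoint_left.1 hST hu (huv f ▸ hv)⟩

/-- If `q_A` is open, then the topologies `τ_q` and `τ_cr` agree. -/
theorem isOpen_tauCR_image
    (hq : @IsOpenMap (PrimSpace A) (Glimm A) inferInstance (tauQ A) (glimmMap A))
    {U : Set (PrimSpace A)} (hU : IsOpen U) : IsOpen[tauCR A] (glimmMap A '' U) := by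
  let _ : TopologicalSpace (Glimm A) := tauCR A
  refine isOpen_iff_mem_nhds.2 ?_
  rintro _ ⟨P, hP, rfl⟩
  -- The separating function is applied to the saturation of `U`; its dropped function is among
  -- those defining `τ_cr`, so `{f < 1}` is a `τ_cr`-neighbourhood inside the image.
  obtain ⟨f, hfP, -, hf⟩ := exists_continuous_separating (glimmSetoid A)
    (isOpenMap_glimmMap_iff.1 hq) (fun _ _ => exists_open_separating_of_not_glimm)
    (isOpenMap_glimmMap_iff.1 hq U hU)
    (fun u ⟨R, hR, hRu⟩ v huv => ⟨R, hR, (glimmSetoid A).trans hRu huv⟩)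
    ⟨P, hP, (glimmSetoid A).refl P⟩
  have hcont : @Continuous _ _ (tauCR A) _ (Glimm.drop f) :=
    continuous_iff_le_induced.2 (iInf_le _ f)
  have hopen : IsOpen[tauCR A] (Glimm.drop f ⁻¹' Set.Iio 1) := isOpen_Iio.preimage hcont
  refine mem_of_superset (hopen.mem_nhds (show f P < 1 by rw [hfP]; exact zero_lt_one)) ?_
  intro G hG
  induction G using Quotient.inductionOn with | _ Q =>
  by_contra hQ
  refine (show f Q < 1 from hG).ne (hf Q ?_)
  rintro ⟨R, hR, hRQ⟩
  exact hQ ⟨R, hR, Quotient.sound hRQ⟩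

theorem exists_norm_bound_of_isOpenMap
    (hq : @IsOpenMap (PrimSpace A) (Glimm A) inferInstance (tauQ A) (glimmMap A))
    {K : Set (Glimm A)} (hK : @IsCompact (Glimm A) (tauCR A) K) :
    ∃ a : A, ∃ α : ℝ, 0 < α ∧ K ⊆ {G | α ≤ quotientNorm a G.ideal} := by
  let _ : TopologicalSpace (Glimm A) := tauCR A
  obtain ⟨t, ht⟩ := hK.elim_finite_subcover (fun b : A => glimmMap A '' normGtOne b)
    (fun b => isOpen_tauCR_image hq (isOpen_normGtOne b)) (fun G _ => by
      induction G using Quotient.inductionOn with | _ P =>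
      obtain ⟨b, hb⟩ := exists_mem_normGtOne P
      exact Set.mem_iUnion.2 ⟨b, P, hb, rfl⟩)
  refine ⟨∑ b ∈ t, star b * b, 1, one_pos, fun G hG => ?_⟩
  obtain ⟨b, hbt, P, hP, rfl⟩ := Set.mem_iUnion₂.1 (ht hG)
  obtain ⟨f, hf, hfb⟩ := normGtOne_subset b hP
  -- The Glimm ideal is contained in `P`, so a quasi-state killing `P` also bounds the norm modulo
  -- the Glimm ideal.
  have hle : (glimmMap A P).ideal ≤ P.1 := sInf_le ⟨P, rfl, rfl⟩
  refine one_le_quotientNorm (quasiStates_anti hle hf) ?_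
  have hsum : f (∑ b ∈ t, star b * b) = ∑ b ∈ t, f (star b * b) :=
    map_sum (AddMonoidHom.mk' f hf.1) _ _
  rw [hsum, Complex.re_sum]
  exact hfb.trans (Finset.single_le_sum (f := fun c : A => (f (star c * c)).re)
    (fun c _ => (sq_nonneg _).trans (hf.2.2.2.1 c)) hbt)

theorem glimm_of_notSeparated {P Q : PrimSpace A} (h : NotSeparated P Q) : glimmSetoid A P Q := by
  by_contra hPQ
  obtain ⟨U, V, hU, hV, hP, hQ, hUV⟩ := exists_open_separating_of_not_glimm hPQ
  obtain ⟨R, hRU, hRV⟩ := h U V hU hV hP hQ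
  exact hUV R hRU R hRV ((glimmSetoid A).refl R)

/-- Disjoint open sets contain no `∼`-related pair across them, so the quotient by `∼` is Hausdorff
and locally compact. A continuous function would then tell apart two inequivalent points. -/
theorem notSeparated_of_glimm (hA : IsQuasiStandard A) {P Q : PrimSpace A}
    (h : glimmSetoid A P Q) : NotSeparated P Q := by
  let r : Setoid (PrimSpace A) := ⟨NotSeparated, hA.1⟩
  have hsep : ∀ P Q : PrimSpace A, ¬ r P Q → ∃ U V : Set (PrimSpace A), IsOpen U ∧ IsOpen V ∧
      P ∈ U ∧ Q ∈ V ∧ ∀ u ∈ U, ∀ v ∈ V, ¬ r u v := fun P Q hPQ => by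
    have hPQ' : ¬ NotSeparated P Q := hPQ
    simp only [NotSeparated, not_forall, Set.not_nonempty_iff_eq_empty] at hPQ'
    obtain ⟨U, V, hU, hV, hP, hQ, hUV⟩ := hPQ'
    refine ⟨U, V, hU, hV, hP, hQ, fun u hu v hv huv => ?_⟩
    exact (huv U V hU hV hu hv).ne_empty hUV
  by_contra hPQ
  obtain ⟨U, V, hU, hV, hP, hQ, hUV⟩ := hsep P Q hPQ
  obtain ⟨f, hfP, -, hf⟩ := exists_continuous_separating r hA.2 hsep (hA.2 U hU)
    (fun u ⟨R, hR, hRu⟩ v huv => ⟨R, hR, r.trans hRu huv⟩) ⟨P, hP, r.refl P⟩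
  have hfQ : f Q = 1 := hf Q fun ⟨R, hR, hRQ⟩ => hUV R hR Q hQ hRQ
  have := h f
  rw [hfP, hfQ] at this
  exact zero_ne_one this

theorem IsQuasiStandard.isOpenMap_glimmMap (hA : IsQuasiStandard A) :
    @IsOpenMap (PrimSpace A) (Glimm A) inferInstance (tauQ A) (glimmMap A) := by
  refine isOpenMap_glimmMap_iff.2 fun U hU => ?_
  convert hA.2 U hU using 6
  exact ⟨notSeparated_of_glimm hA, glimm_of_notSeparated⟩

end Glimm

end CStarGlimm

theorem mainTheorem4 {A : Type*} [NonUnitalCStarAlgebra A] :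
    (@IsOpenMap (CStarGlimm.PrimSpace A) (CStarGlimm.Glimm A) inferInstance (CStarGlimm.tauQ A)
        (CStarGlimm.glimmMap A) →
      ∀ K : Set (CStarGlimm.Glimm A), @IsCompact (CStarGlimm.Glimm A) (CStarGlimm.tauCR A) K →
        ∃ a : A, ∃ α : ℝ, 0 < α ∧ K ⊆ {G | α ≤ CStarGlimm.quotientNorm a G.ideal}) ∧
    (CStarGlimm.IsQuasiStandard A →
      @IsOpenMap (CStarGlimm.PrimSpace A) (CStarGlimm.Glimm A) inferInstance (CStarGlimm.tauQ A)
        (CStarGlimm.glimmMap A) ∧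
      ∀ K : Set (CStarGlimm.Glimm A), @IsCompact (CStarGlimm.Glimm A) (CStarGlimm.tauCR A) K →
        ∃ a : A, ∃ α : ℝ, 0 < α ∧ K ⊆ {G | α ≤ CStarGlimm.quotientNorm a G.ideal}) :=
  ⟨fun hq _ hK => CStarGlimm.exists_norm_bound_of_isOpenMap hq hK,
    fun hA => ⟨hA.isOpenMap_glimmMap,
      fun _ hK => CStarGlimm.exists_norm_bound_of_isOpenMap hA.isOpenMap_glimmMap hK⟩⟩
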